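/- Let $X$ be a quandle, with operation $(a,b)\mapsto a*b$, and let $H_n^Q(X)$ be its integral quandle homology: the homology of $C_n^Q(X)=\mathbb{Z}X^n/C_n^D(X)$, where $C_n^D(X)$ is spanned by the tuples with two equal consecutive entries and $$\partial(x_1,\dots,x_n)=\sum_{i=2}^n(-1)^i\big((x_1,\dots,x_{i-1},x_{i+1},\dots,x_n)-(x_1*x_i,\dots,x_{i-1}*x_i,x_{i+1},\dots,x_n)\big).$$ Let $D$ be an oriented diagram, in a disk, of a tangle consisting of $n\ge 1$ disjoint arcs in the 3-ball. Normals to the curve are chosen so that (tangent, normal) is the orientation of the plane. A coloring of a tangle or link diagram assigns to each arc an element of $X$ such that at each crossing $C(r_2)=C(r_1)*C(r)$, where $r$ is the over-arc and its normal points from the under-arc $r_1$ to the under-arc $r_2$. A shadow coloring also assigns to each region an element of $X$ such that, if the normal to an arc colored $x$ points from the region $R_1$ to the region $R_2$, then the color of $R_2$ is $w*x$, where $w$ is the color of $R_1$. A (shadow) coloring of $D$ is boundary-monochromatic if all boundary points of $D$ receive the same color. A closure of $D$ is a link diagram obtained by joining the boundary points outside the disk by pairwise disjoint simple arcs compatible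 with the orientation. To a coloring one assigns the 2-chain $\sum\pm(x,y)$ over all crossings, and to a shadow coloring the 3-chain $\sum\pm(w,x,y)$ over all crossings, where the sign is that of the crossing, $y$ is the color of the over-arc, $x$ is the color of the under-arc away from which the normal of the over-arc points, and $w$ is the color of the region near the crossing from which the normals of both strands point away. Then $D$ has a closure, and: (1) Every boundary-monochromatic coloring $\alpha$ of $D$ by $X$ extends uniquely to a coloring of any closure of $D$. There is exactly one element $z\in H_2^Q(X)$ such that, for every closure of $D$, the 2-chain of the extension of $\alpha$ is a cycle that represents $z$. (2) Every boundary-monochromatic shadow coloring $\alpha$ of $D$ by $X$ extends uniquely to a shadow coloring of any closure of $D$. There is exactly one element $z\in H_3^Q(X)$ such that, for every closure of $D$, the 3-chain of the extension of $\alpha$ is a cycle that represents $z$. -/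

import Mathlib

open scoped Quandles

namespace QuandleTangle

/-- The quandle operation in right-action form: `a ⋆ b` is `a` acted on by `b`. -/
def rop {X : Type*} [Quandle X] (a b : X) : X := b ◃ a

infixl:70 " ⋆ " => rop

/-! ### Quandle homology -/

section Homology

set_option linter.unusedSectionVars false

variable (X : Type*) [Quandle X]

/-- The free abelian group on the `n`-tuples of elements of `X`. -/
abbrev RackChain (n : ℕ) : Type _ := (Fin n → X) →₀ ℤ

variable {X}

/-- `(x₀, …, xₙ) ↦ (x₀, …, xᵢ₋₁, xᵢ₊₁, …, xₙ)`. -/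
def delFace {n : ℕ} (i : Fin (n + 1)) (x : Fin (n + 1) → X) : Fin n → X :=
  fun j => if j.castSucc < i then x j.castSucc else x j.succ

/-- `(x₀, …, xₙ) ↦ (x₀ ⋆ xᵢ, …, xᵢ₋₁ ⋆ xᵢ, xᵢ₊₁, …, xₙ)`. -/
def actFace {n : ℕ} (i : Fin (n + 1)) (x : Fin (n + 1) → X) : Fin n → X :=
  fun j => if j.castSucc < i then x j.castSucc ⋆ x i else x j.succ

variable (X)

/-- The boundary homomorphism from `(n+1)`-chains to `n`-chains. With entries numbered from `1`,
the summation index `i : Fin n` stands for the entry number `i + 2`. -/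
noncomputable def rackBoundary (n : ℕ) : RackChain X (n + 1) →ₗ[ℤ] RackChain X n :=
  Finsupp.linearCombination ℤ fun x =>
    ∑ i : Fin n, (-1 : ℤ) ^ ((i : ℕ) + 2) •
      (Finsupp.single (delFace i.succ x) 1 - Finsupp.single (actFace i.succ x) 1)

/-- The subgroup of degenerate chains, generated by the tuples with two equal consecutive
entries. -/
noncomputable def degenerate (n : ℕ) : Submodule ℤ (RackChain X n) :=
  Submodule.span ℤ
    {s | ∃ x : Fin n → X, (∃ j k : Fin n, (k : ℕ) = j + 1 ∧ x k = x j) ∧ s = Finsupp.single x 1}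

/-- The `i`-th summand of the boundary, including the vanishing one for `i = 0`. -/
noncomputable def faceDiff {n : ℕ} (i : Fin (n + 1)) : RackChain X (n + 1) →ₗ[ℤ] RackChain X n :=
  Finsupp.linearCombination ℤ fun x =>
    Finsupp.single (delFace i x) 1 - Finsupp.single (actFace i x) 1

variable {X}

theorem faceDiff_single {n : ℕ} (i : Fin (n + 1)) (x : Fin (n + 1) → X) :
    faceDiff X i (Finsupp.single x 1) =
      Finsupp.single (delFace i x) 1 - Finsupp.single (actFace i x) 1 := by
  simp [faceDiff]

theorem rackBoundary_eq (n : ℕ) :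
    rackBoundary X n = ∑ i : Fin (n + 1), (-1 : ℤ) ^ ((i : ℕ) + 1) • faceDiff X i := by
  refine Finsupp.lhom_ext' fun x => LinearMap.ext_ring ?_
  change rackBoundary X n (Finsupp.single x 1) =
    (∑ i : Fin (n + 1), (-1 : ℤ) ^ ((i : ℕ) + 1) • faceDiff X i) (Finsupp.single x 1)
  have h0 : faceDiff X (0 : Fin (n + 1)) (Finsupp.single x 1) = 0 := by
    rw [faceDiff_single, sub_eq_zero]
    congr 1
  have hx : rackBoundary X n (Finsupp.single x 1) = ∑ i : Fin n, (-1 : ℤ) ^ ((i : ℕ) + 2) •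
      (Finsupp.single (delFace i.succ x) 1 - Finsupp.single (actFace i.succ x) 1) := by
    simp [rackBoundary]
  rw [hx, LinearMap.sum_apply, Fin.sum_univ_succ]
  simp only [LinearMap.smul_apply, h0, smul_zero, zero_add, faceDiff_single, Fin.val_succ]

theorem single_mem_degenerate {n : ℕ} {x : Fin n → X} (j k : Fin n) (hk : (k : ℕ) = j + 1)
    (hx : x k = x j) : Finsupp.single x 1 ∈ degenerate X n :=
  Submodule.subset_span ⟨x, ⟨j, k, hk, hx⟩, rfl⟩

/-- The degenerate chains form a subcomplex. -/
theorem degenerate_le_comap (n : ℕ) :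
    degenerate X (n + 1) ≤ (degenerate X n).comap (rackBoundary X n) := by
  refine Submodule.span_le.2 ?_
  rintro _ ⟨x, ⟨j, k, hk, hx⟩, rfl⟩
  change rackBoundary X n (Finsupp.single x 1) ∈ degenerate X n
  have hjk : j ≠ k := fun h => by rw [h] at hk; omega
  rw [rackBoundary_eq, LinearMap.sum_apply, ← Finset.add_sum_erase _ _ (Finset.mem_univ j),
    ← Finset.add_sum_erase _ _ (Finset.mem_erase.2 ⟨hjk.symm, Finset.mem_univ k⟩), ← add_assoc]
  refine Submodule.add_mem _ ?_ (Submodule.sum_mem _ fun i hi => ?_)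
  · have hd : delFace k x = delFace j x := by
      funext m
      simp only [delFace, Fin.lt_def, Fin.val_castSucc]
      by_cases hm : (m : ℕ) = j
      · have h1 : m.castSucc = j := Fin.ext hm
        have h2 : m.succ = k := Fin.ext (by simp [hk, hm])
        rw [if_pos (by omega), if_neg (by omega), h1, h2, hx]
      · by_cases hm' : (m : ℕ) < j
        · rw [if_pos (by omega), if_pos hm']
        · rw [if_neg (by omega), if_neg hm']
    have ha : actFace k x = actFace j x := by
      funext m
      simp only [actFace, Fin.lt_def, Fin.val_castSucc]
      by_cases hm : (m : ℕ) = j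
      · have h1 : m.castSucc = j := Fin.ext hm
        have h2 : m.succ = k := Fin.ext (by simp [hk, hm])
        rw [if_pos (by omega), if_neg (by omega), h1, h2, hx]
        exact Quandle.fix
      · by_cases hm' : (m : ℕ) < j
        · rw [if_pos (by omega), if_pos hm', hx]
        · rw [if_neg (by omega), if_neg hm']
    have hz : ((-1 : ℤ) ^ ((j : ℕ) + 1) • faceDiff X j) (Finsupp.single x 1) +
        ((-1 : ℤ) ^ ((k : ℕ) + 1) • faceDiff X k) (Finsupp.single x 1) = 0 := by
      rw [LinearMap.smul_apply, LinearMap.smul_apply, faceDiff_single, faceDiff_single, hd, ha, hk,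
        pow_succ _ ((j : ℕ) + 1), mul_neg_one, neg_smul, add_neg_cancel]
    rw [hz]
    exact Submodule.zero_mem _
  · obtain ⟨hik, hij, -⟩ : i ≠ k ∧ i ≠ j ∧ True := by simpa using hi
    have hik' : (i : ℕ) ≠ k := fun h => hik (Fin.ext h)
    have hij' : (i : ℕ) ≠ j := fun h => hij (Fin.ext h)
    rw [LinearMap.smul_apply, faceDiff_single]
    refine Submodule.smul_mem _ _ ?_
    have hkn := k.isLt
    have hin := i.isLt
    by_cases hlt : (k : ℕ) < i
    · have hj1 : (⟨j, by omega⟩ : Fin n).castSucc = j := rfl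
      have hk1 : (⟨k, by omega⟩ : Fin n).castSucc = k := rfl
      refine Submodule.sub_mem _ (single_mem_degenerate ⟨j, by omega⟩ ⟨k, by omega⟩ hk ?_)
        (single_mem_degenerate ⟨j, by omega⟩ ⟨k, by omega⟩ hk ?_)
      · simp only [delFace, hj1, hk1, Fin.lt_def]
        rw [if_pos (by omega), if_pos (by omega), hx]
      · simp only [actFace, hj1, hk1, Fin.lt_def]
        rw [if_pos (by omega), if_pos (by omega), hx]
    · have hj0 : 0 < (j : ℕ) := by omega
      have hj1 : (⟨j - 1, by omega⟩ : Fin n).succ = j := Fin.ext (by simp; omega)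
      have hk1 : (⟨k - 1, by omega⟩ : Fin n).succ = k := Fin.ext (by simp; omega)
      refine Submodule.sub_mem _
        (single_mem_degenerate ⟨j - 1, by omega⟩ ⟨k - 1, by omega⟩ (by simp; omega) ?_)
        (single_mem_degenerate ⟨j - 1, by omega⟩ ⟨k - 1, by omega⟩ (by simp; omega) ?_)
      · simp only [delFace, hj1, hk1, Fin.lt_def, Fin.val_castSucc]
        rw [if_neg (by omega), if_neg (by omega), hx]
      · simp only [actFace, hj1, hk1, Fin.lt_def, Fin.val_castSucc]
        rw [if_neg (by omega), if_neg (by omega), hx]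

theorem faceDiff_faceDiff {n : ℕ} (i : Fin (n + 1)) (j : Fin (n + 2)) (j' : Fin (n + 1))
    (h : (j : ℕ) ≤ i) (hj : (j' : ℕ) = j) (c : RackChain X (n + 2)) :
    faceDiff X i (faceDiff X j c) = faceDiff X j' (faceDiff X i.succ c) := by
  obtain rfl : j = j'.castSucc := Fin.ext hj.symm
  rw [Fin.val_castSucc] at h
  have key : faceDiff X i ∘ₗ faceDiff X j'.castSucc = faceDiff X j' ∘ₗ faceDiff X i.succ := by
    refine Finsupp.lhom_ext' fun x => LinearMap.ext_ring ?_
    change faceDiff X i (faceDiff X j'.castSucc (Finsupp.single x 1)) =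
      faceDiff X j' (faceDiff X i.succ (Finsupp.single x 1))
    have e1 : delFace i (delFace j'.castSucc x) = delFace j' (delFace i.succ x) := by
      funext m
      simp only [delFace, Fin.lt_def, Fin.val_castSucc, Fin.val_succ, Fin.succ_castSucc]
      split_ifs <;> first | rfl | omega
    have e2 : delFace i (actFace j'.castSucc x) = actFace j' (delFace i.succ x) := by
      funext m
      simp only [delFace, actFace, Fin.lt_def, Fin.val_castSucc, Fin.val_succ, Fin.succ_castSucc]
      split_ifs <;> first | rfl | omega
    have e3 : actFace i (delFace j'.castSucc x) = delFace j' (actFace i.succ x) := by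
      funext m
      simp only [delFace, actFace, Fin.lt_def, Fin.val_castSucc, Fin.val_succ, Fin.succ_castSucc]
      split_ifs <;> first | rfl | omega
    have e4 : actFace i (actFace j'.castSucc x) = actFace j' (actFace i.succ x) := by
      funext m
      simp only [actFace, Fin.lt_def, Fin.val_castSucc, Fin.val_succ, Fin.succ_castSucc]
      split_ifs <;> first | rfl | omega | exact Shelf.self_distrib
    rw [faceDiff_single, faceDiff_single, map_sub, map_sub, faceDiff_single, faceDiff_single,
      faceDiff_single, faceDiff_single, e1, e2, e3, e4]
    abel
  exact LinearMap.congr_fun key c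

/-- The rack chains form a chain complex. -/
theorem rackBoundary_comp (n : ℕ) : rackBoundary X n ∘ₗ rackBoundary X (n + 1) = 0 := by
  rw [rackBoundary_eq, rackBoundary_eq]
  refine LinearMap.ext fun c => ?_
  simp only [LinearMap.comp_apply, LinearMap.sum_apply, map_sum, LinearMap.smul_apply, map_smul,
    LinearMap.zero_apply, Finset.smul_sum, smul_smul]
  rw [← Finset.sum_product']
  let P := Fin (n + 2) × Fin (n + 1)
  let S : Finset P := {p : P | (p.1 : ℕ) ≤ p.2}
  rw [Finset.univ_product_univ, ← Finset.sum_add_sum_compl S, ← eq_neg_iff_add_eq_zero,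
    ← Finset.sum_neg_distrib]
  refine Finset.sum_bij (fun p hp =>
    (p.2.succ, ⟨p.1, lt_of_le_of_lt (Finset.mem_filter.mp hp).2 p.2.isLt⟩)) ?_ ?_ ?_ ?_
  · intro p hp
    simp only [S, Finset.mem_filter, Finset.mem_univ, true_and, Finset.mem_compl,
      Fin.val_succ] at hp ⊢
    omega
  · rintro ⟨a, b⟩ hp ⟨a', b'⟩ hp' h
    have h1 : b = b' := Fin.succ_injective _ (congrArg Prod.fst h)
    have h2 : (a : ℕ) = a' := congrArg (fun q => (q.2 : ℕ)) h
    exact Prod.ext (Fin.ext h2) h1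
  · rintro ⟨a, b⟩ hp
    simp only [S, Finset.mem_filter, Finset.mem_univ, true_and, Finset.mem_compl, not_le] at hp
    refine ⟨(b.castSucc, a.pred fun h => by simp [h] at hp), ?_, ?_⟩
    · simp [S]; omega
    · simp
  · rintro ⟨a, b⟩ hp
    simp only [S, Finset.mem_filter, Finset.mem_univ, true_and] at hp
    rw [faceDiff_faceDiff b a ⟨a, by omega⟩ hp rfl, ← neg_smul]
    congr 1
    simp only [Fin.val_succ, pow_add]
    ring

variable (X)

/-- Quandle chains: rack chains modulo degenerate chains. -/
abbrev QuandleChain (n : ℕ) : Type _ := RackChain X n ⧸ degenerate X n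

/-- The boundary of the quandle chain complex. -/
noncomputable def quandleBoundary (n : ℕ) : QuandleChain X (n + 1) →ₗ[ℤ] QuandleChain X n :=
  (degenerate X (n + 1)).mapQ (degenerate X n) (rackBoundary X n) (degenerate_le_comap n)

/-- The group of quandle `n`-cycles. -/
noncomputable def quandleCycles : (n : ℕ) → Submodule ℤ (QuandleChain X n)
  | 0 => ⊤
  | n + 1 => LinearMap.ker (quandleBoundary X n)

/-- The group of quandle `n`-boundaries. -/
noncomputable def quandleBoundaries (n : ℕ) : Submodule ℤ (QuandleChain X n) :=
  LinearMap.range (quandleBoundary X n)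

theorem quandleBoundaries_le_cycles (n : ℕ) : quandleBoundaries X n ≤ quandleCycles X n := by
  cases n with
  | zero => exact le_top
  | succ n =>
    rintro _ ⟨c, rfl⟩
    obtain ⟨c, rfl⟩ := Submodule.Quotient.mk_surjective _ c
    change Submodule.Quotient.mk ((rackBoundary X n ∘ₗ rackBoundary X (n + 1)) c) = 0
    rw [rackBoundary_comp]
    rfl

/-- The quandle homology group of degree `n` with integer coefficients, cycles modulo
boundaries. -/
abbrev QuandleHomology (n : ℕ) : Type _ :=
  quandleCycles X n ⧸ (quandleBoundaries X n).submoduleOf (quandleCycles X n)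

end Homology

end QuandleTangle

namespace QuandleTangle

/-! ### Oriented diagrams: arcs, regions, colorings and their chains -/

/-- The two sides of an oriented curve. The normal vector points to the left side, so that
(tangent, normal) is the usual orientation of the plane. -/
inductive Side
  | left
  | right

/-- The incidence data of an oriented diagram. The underlying immersed curve is cut into oriented
pieces at the crossings, and possibly at further points. -/
structure Diagram where
  /-- the crossings -/
  Crossing : Type
  [fintypeCrossing : Fintype Crossing]
  /-- the sign of a crossing: it is `1` if (tangent of the over-strand, tangent of the
  under-strand) is the usual orientation of the plane, and `-1` otherwise -/
  sign : Crossing → ℤˣ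
  /-- the oriented pieces of the curve -/
  Piece : Type
  /-- the piece of the over-strand that ends at the crossing -/
  overIn : Crossing → Piece
  /-- the piece of the over-strand that starts at the crossing -/
  overOut : Crossing → Piece
  /-- the piece of the under-strand that ends at the crossing -/
  underIn : Crossing → Piece
  /-- the piece of the under-strand that starts at the crossing -/
  underOut : Crossing → Piece
  /-- `Continues p q`: the end of `p` is the start of `q`, at a point that is not a crossing -/
  Continues : Piece → Piece → Prop
  /-- further pairs of sides of pieces that border a common region -/
  Cobounds : Piece × Side → Piece × Side → Prop

namespace Diagram

attribute [instance] Diagram.fintypeCrossing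

variable (K : Diagram)

/-- Two consecutive pieces that are not separated by an under-crossing. -/
inductive ArcStep : K.Piece → K.Piece → Prop
  | over (c : K.Crossing) : ArcStep (K.overIn c) (K.overOut c)
  | continues {p q : K.Piece} : K.Continues p q → ArcStep p q

/-- The arcs (over-arcs) of the diagram: maximal parts of the curve without under-crossings in
their interior. -/
def Arc : Type := Quot K.ArcStep

/-- The arc that contains a piece. -/
def arc (p : K.Piece) : K.Arc := Quot.mk _ p

/-- Two sides of pieces that visibly border the same region: around a crossing there are four
corners, each between two neighbouring pieces; counterclockwise around a positive crossing the
pieces are `overOut`, `underOut`, `overIn`, `underIn`, and around a negative one `overOut`,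
`underIn`, `overIn`, `underOut`. -/
inductive RegionStep : K.Piece × Side → K.Piece × Side → Prop
  | pos₁ {c : K.Crossing} : K.sign c = 1 →
      RegionStep (K.overOut c, .left) (K.underOut c, .right)
  | pos₂ {c : K.Crossing} : K.sign c = 1 →
      RegionStep (K.underOut c, .left) (K.overIn c, .left)
  | pos₃ {c : K.Crossing} : K.sign c = 1 →
      RegionStep (K.overIn c, .right) (K.underIn c, .left)
  | pos₄ {c : K.Crossing} : K.sign c = 1 →
      RegionStep (K.underIn c, .right) (K.overOut c, .right)
  | neg₁ {c : K.Crossing} : K.sign c = -1 →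
      RegionStep (K.overOut c, .left) (K.underIn c, .left)
  | neg₂ {c : K.Crossing} : K.sign c = -1 →
      RegionStep (K.underIn c, .right) (K.overIn c, .left)
  | neg₃ {c : K.Crossing} : K.sign c = -1 →
      RegionStep (K.overIn c, .right) (K.underOut c, .right)
  | neg₄ {c : K.Crossing} : K.sign c = -1 →
      RegionStep (K.underOut c, .left) (K.overOut c, .right)
  | continues {p q : K.Piece} (s : Side) : K.Continues p q → RegionStep (p, s) (q, s)
  | cobounds {a b : K.Piece × Side} : K.Cobounds a b → RegionStep a b

/-- The regions into which the diagram divides the surface it is drawn on. -/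
def Region : Type := Quot K.RegionStep

/-- The region on a given side of a piece. -/
def region (p : K.Piece) (s : Side) : K.Region := Quot.mk _ (p, s)

/-- The under-arc at a crossing away from which the normal of the over-arc points. -/
def underSource (c : K.Crossing) : K.Arc :=
  if K.sign c = 1 then K.arc (K.underIn c) else K.arc (K.underOut c)

/-- The under-arc at a crossing towards which the normal of the over-arc points. -/
def underTarget (c : K.Crossing) : K.Arc :=
  if K.sign c = 1 then K.arc (K.underOut c) else K.arc (K.underIn c)

/-- The source region at a crossing: the normals of both strands point away from it. It is the
corner on the right of both strands. -/
def sourceRegion (c : K.Crossing) : K.Region :=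
  if K.sign c = 1 then K.region (K.overOut c) .right else K.region (K.overIn c) .right

/-- A quandle coloring of an oriented diagram. -/
structure Coloring (X : Type*) [Quandle X] where
  /-- the color of an arc -/
  color : K.Arc → X
  rule : ∀ c : K.Crossing,
    color (K.underTarget c) = color (K.underSource c) ⋆ color (K.arc (K.overIn c))

/-- A shadow coloring of an oriented diagram: also the regions are colored. -/
structure ShadowColoring (X : Type*) [Quandle X] extends Coloring K X where
  /-- the color of a region -/
  regionColor : K.Region → X
  region_rule : ∀ p : K.Piece,
    regionColor (K.region p .left) = regionColor (K.region p .right) ⋆ color (K.arc p)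

variable {K} {X : Type*} [Quandle X]

/-- The quandle 2-chain of a coloring: the sum of the terms `± (x, y)` over all crossings, with
`y` the color of the over-arc and `x` that of the under-arc away from which the normal of the
over-arc points. -/
noncomputable def Coloring.chain (α : K.Coloring X) : QuandleChain X 2 :=
  ∑ c : K.Crossing, (K.sign c : ℤ) • Submodule.Quotient.mk
    (Finsupp.single ![α.color (K.underSource c), α.color (K.arc (K.overIn c))] 1)

/-- The quandle 3-chain of a shadow coloring: the sum of the terms `± (w, x, y)` over all
crossings, with `w` the color of the source region, and `x`, `y` as for colorings. -/
noncomputable def ShadowColoring.chain (α : K.ShadowColoring X) : QuandleChain X 3 :=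
  ∑ c : K.Crossing, (K.sign c : ℤ) • Submodule.Quotient.mk
    (Finsupp.single ![α.regionColor (K.sourceRegion c), α.color (K.underSource c),
      α.color (K.arc (K.overIn c))] 1)

end Diagram

/-- The chain `c` is a cycle, and its homology class is `z`. -/
def Represents {X : Type*} [Quandle X] {n : ℕ} (c : QuandleChain X n) (z : QuandleHomology X n) :
    Prop :=
  ∃ h : c ∈ quandleCycles X n, Submodule.Quotient.mk ⟨c, h⟩ = z

/-! ### Tangle diagrams -/

/-- The two strands at a crossing. -/
inductive Level
  | over
  | under

/-- The combinatorial data of an oriented tangle diagram in a disk, up to planarity. -/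
structure TangleCode where
  /-- the number of crossings -/
  crossings : ℕ
  /-- half the number of boundary points -/
  strands : ℕ
  sign : Fin crossings → ℤˣ
  /-- whether the strand at a boundary point is directed into the disk; the boundary points are
  numbered counterclockwise along the boundary circle -/
  entry : Fin (2 * strands) → Bool
  /-- The edges of the diagram. An edge starts at a crossing, on its over- or under-strand, or at a
  boundary point where a strand enters the disk; it ends at a crossing, on its over- or
  under-strand, or at a boundary point where a strand leaves the disk. -/
  next : (Fin crossings × Level) ⊕ {i // entry i = true} ≃
    (Fin crossings × Level) ⊕ {i // entry i = false}

namespace TangleCode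

variable (D : TangleCode)

/-- The edges, each given by its starting point. -/
abbrev Edge : Type := (Fin D.crossings × Level) ⊕ {i // D.entry i = true}

/-- The edge at a boundary point. -/
def boundaryEdge (i : Fin (2 * D.strands)) : D.Edge :=
  if h : D.entry i = true then .inr ⟨i, h⟩
  else D.next.symm (.inr ⟨i, Bool.eq_false_iff.2 h⟩)

/-- The side of the edge at the boundary point `i` that faces the next boundary point in
counterclockwise direction. -/
def ccwSide (i : Fin (2 * D.strands)) : Side := if D.entry i then .right else .left

/-- The side of the edge at the boundary point `i` that faces the next boundary point in clockwise
direction. -/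
def cwSide (i : Fin (2 * D.strands)) : Side := if D.entry i then .left else .right

/-- Two sides of edges that border a common segment of the boundary circle. -/
inductive SegmentStep : D.Edge × Side → D.Edge × Side → Prop
  | mk (i : Fin (2 * D.strands)) :
      SegmentStep (D.boundaryEdge i, D.ccwSide i)
        (D.boundaryEdge (finRotate _ i), D.cwSide (finRotate _ i))

/-- The tangle diagram as a diagram drawn in the disk. -/
def diagram : Diagram where
  Crossing := Fin D.crossings
  sign := D.sign
  Piece := D.Edge
  overIn c := D.next.symm (.inl (c, .over))
  overOut c := .inl (c, .over)
  underIn c := D.next.symm (.inl (c, .under))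
  underOut c := .inl (c, .under)
  Continues _ _ := False
  Cobounds := D.SegmentStep

/-- The edge `e` ends at a crossing, and `f` continues it straight through that crossing. -/
def Follows (e f : D.Edge) : Prop :=
  ∃ c : Fin D.crossings × Level, D.next e = .inl c ∧ f = .inl c

end TangleCode

/-- An oriented diagram of a tangle of `strands ≥ 1` arcs in the 3-ball.

As there are no closed components, the diagram becomes a connected graph on the sphere when the
complement of the disk is collapsed to a vertex; its faces are the regions of the diagram. This
graph has `crossings + 1` vertices and `2 * crossings + strands` edges, and it is planar if and
only if the Euler characteristic is 2. -/
structure TangleDiagram extends TangleCode where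
  strands_pos : 0 < strands
  /-- every edge lies on a strand that starts at a boundary point -/
  no_closed_component : ∀ e : toTangleCode.Edge, ∃ i, 
    Relation.ReflTransGen toTangleCode.Follows (.inr i) e
  /-- Euler's formula -/
  planar : (Nat.card toTangleCode.diagram.Region : ℤ) + (crossings + 1) -
    (2 * crossings + strands) = 2

namespace TangleDiagram

variable (D : TangleDiagram)

/-- A closure of a tangle diagram: the boundary points are joined outside the disk by pairwise
disjoint simple arcs that match the orientation. -/
structure Closure where
  /-- the outer arc that starts at `i` ends at `join i` -/
  join : {i // D.entry i = false} ≃ {i // D.entry i = true}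
  /-- the outer arcs do not cross: their pairs of end points do not separate each other on the
  boundary circle -/
  noncrossing : ∀ p q : {i // D.entry i = false},
    ¬ (min p.1 (join p).1 < min q.1 (join q).1 ∧ min q.1 (join q).1 < max p.1 (join p).1 ∧
      max p.1 (join p).1 < max q.1 (join q).1)

namespace Closure

variable {D} (K : D.Closure)

/-- Consecutive pieces of the closure at the boundary points of the disk. -/
inductive Continues : D.Edge ⊕ {i // D.entry i = false} → D.Edge ⊕ {i // D.entry i = false} → Prop
  | leave (i : {i // D.entry i = false}) : Continues (.inl (D.next.symm (.inr i))) (.inr i)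
  | enter (i : {i // D.entry i = false}) : Continues (.inr i) (.inl (.inr (K.join i)))

/-- Inner regions are connected with outer regions through the segments of the boundary circle of
the disk, which is not part of the link diagram. -/
inductive Cobounds : (D.Edge ⊕ {i // D.entry i = false}) × Side →
    (D.Edge ⊕ {i // D.entry i = false}) × Side → Prop
  | segment {a b : D.Edge × Side} :
      D.SegmentStep a b → Cobounds (.inl a.1, a.2) (.inl b.1, b.2)

/-- The link diagram that is obtained from the tangle diagram by adding the outer arcs. Its pieces
are the edges of the tangle diagram and the outer arcs. -/
def diagram : Diagram where
  Crossing := Fin D.crossings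
  sign := D.sign
  Piece := D.Edge ⊕ {i // D.entry i = false}
  overIn c := .inl (D.next.symm (.inl (c, .over)))
  overOut c := .inl (.inl (c, .over))
  underIn c := .inl (D.next.symm (.inl (c, .under)))
  underOut c := .inl (.inl (c, .under))
  Continues := K.Continues
  Cobounds := Cobounds

variable {X : Type*} [Quandle X]

/-- The coloring `β` of the closure agrees on the disk with the coloring `α`. -/
def Extends (β : K.diagram.Coloring X) (α : D.diagram.Coloring X) : Prop :=
  ∀ e : D.Edge, β.color (K.diagram.arc (.inl e)) = α.color (D.diagram.arc e)

/-- The shadow coloring `β` of the closure agrees on the disk with the shadow coloring `α`. -/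
def ShadowExtends (β : K.diagram.ShadowColoring X) (α : D.diagram.ShadowColoring X) : Prop :=
  K.Extends β.toColoring α.toColoring ∧ ∀ (e : D.Edge) (s : Side),
    β.regionColor (K.diagram.region (.inl e) s) = α.regionColor (D.diagram.region e s)

end Closure

/-- A coloring is boundary-monochromatic if all boundary points receive the same color. -/
def BoundaryMonochromatic {X : Type*} [Quandle X] (α : D.diagram.Coloring X) : Prop :=
  ∀ i j, α.color (D.diagram.arc (D.boundaryEdge i)) = α.color (D.diagram.arc (D.boundaryEdge j))

end TangleDiagram

end QuandleTangle

open QuandleTangle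

/-! A closure adds no crossings, so the chain of an extension is literally the chain of the coloring
of the tangle (`Extends.chain_eq`, `ShadowExtends.chain_eq`). Independence of the closure is then
immediate. What remains is that a closure exists, that colorings extend uniquely, and that the chain
is a cycle.

Existence: equally many strands enter and leave the disk, and repeatedly joining a closest pair of
opposite boundary points gives a noncrossing matching.

Extension: an outer arc must carry the colors of the edge it continues, which gives uniqueness. For
arc colors, consistency at its other end is monochromaticity. For region colors, let a be the common
boundary color. Walking counterclockwise along the boundary circle, each boundary point applies the
action of a or its inverse, according to the direction of the strand. An outer arc separates the
other boundary points into matched pairs, so the exponents between its ends sum to zero and the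
colors at both ends agree (`Closure.regionColor_join`).

Cycles: up to a global sign, the boundary of each crossing term is a difference of values attached
to the edges that start and end there. Summed over all crossings, only boundary points contribute,
and they cancel in pairs along the outer arcs. -/

namespace QuandleTangle

/-! ### Noncrossing matchings -/

/-- In a finite set of positions with as many positions of either kind, the positions of the two
kinds can be matched without crossings. -/
theorem exists_noncrossing_involution {m : ℕ} (b : Fin m → Bool) (S : Finset (Fin m))
    (hS : (S.filter fun i => b i = true).card = (S.filter fun i => b i = false).card) :
    ∃ f : Fin m → Fin m, (∀ x ∈ S, f x ∈ S ∧ f (f x) = x ∧ b (f x) = !b x) ∧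
      ∀ x ∈ S, ∀ y ∈ S, ¬ (x < y ∧ y < f x ∧ f x < f y) := by
  induction hn : S.card using Nat.strong_induction_on generalizing S with
  | _ n ih =>
  rcases S.eq_empty_or_nonempty with rfl | ⟨x₀, hx₀⟩
  · exact ⟨id, by simp, by simp⟩
  have hopp : ∃ y ∈ S, b y ≠ b x₀ := by
    by_contra! hall
    cases hb : b x₀ with
    | true =>
      have h1 : x₀ ∈ S.filter fun i => b i = true := by simp [hx₀, hb]
      have h2 : (S.filter fun i => b i = false) = ∅ :=
        Finset.filter_eq_empty_iff.2 fun y hy => by simp [hall y hy, hb]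
      rw [h2, Finset.card_empty, Finset.card_eq_zero] at hS
      simp [hS] at h1
    | false =>
      have h1 : x₀ ∈ S.filter fun i => b i = false := by simp [hx₀, hb]
      have h2 : (S.filter fun i => b i = true) = ∅ :=
        Finset.filter_eq_empty_iff.2 fun y hy => by simp [hall y hy, hb]
      rw [h2, Finset.card_empty, eq_comm, Finset.card_eq_zero] at hS
      simp [hS] at h1
  -- The distance is quantified outermost so that `Nat.find` yields a closest pair of opposite
  -- kinds.
  have hpair : ∃ d : ℕ, ∃ x ∈ S, ∃ y ∈ S, b x ≠ b y ∧ x < y ∧ (y : ℕ) = x + d := by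
    obtain ⟨y₀, hy₀, hne⟩ := hopp
    rcases lt_trichotomy x₀ y₀ with h | h | h
    · exact ⟨y₀ - x₀, x₀, hx₀, y₀, hy₀, hne.symm, h, by omega⟩
    · exact absurd (congrArg b h.symm) hne
    · exact ⟨x₀ - y₀, y₀, hy₀, x₀, hx₀, hne, h, by omega⟩
  classical
  obtain ⟨x, hx, y, hy, hxy, hlt, hd⟩ := Nat.find_spec hpair
  have hmin := fun d => Nat.find_min hpair (m := d)
  -- A position strictly between differs in kind from `x` or from `y`, and would form a closer pair
  -- with that one.
  have hgap : ∀ z ∈ S, ¬ (x < z ∧ z < y) := by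
    rintro z hz ⟨h1, h2⟩
    by_cases hbz : b z = b x
    · exact hmin (y - z) (by omega) ⟨z, hz, y, hy, by rwa [hbz], h2, by omega⟩
    · exact hmin (z - x) (by omega) ⟨x, hx, z, hz, fun h => hbz h.symm, h1, by omega⟩
  let T := (S.erase x).erase y
  have hyx : y ∈ S.erase x := Finset.mem_erase.2 ⟨hlt.ne', hy⟩
  have hT : T.card < n := by
    rw [← hn]
    exact (Finset.card_erase_lt_of_mem hyx).trans_le (Finset.card_erase_le)
  have hbal : (T.filter fun i => b i = true).card = (T.filter fun i => b i = false).card := by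
    -- Exactly one of `x` and `y` has kind `v`, so removing both keeps the balance.
    have key : ∀ v : Bool, (T.filter fun i => b i = v).card + 1 =
        (S.filter fun i => b i = v).card := by
      intro v
      simp only [T, Finset.filter_erase]
      by_cases hv : b x = v
      · rw [Finset.erase_eq_of_notMem (a := y), Finset.card_erase_add_one]
        · simp [hx, hv]
        · simp only [Finset.mem_erase, Finset.mem_filter]
          rintro ⟨-, -, h⟩
          exact hxy (hv.trans h.symm)
      · rw [Finset.erase_eq_of_notMem (a := x), Finset.card_erase_add_one]
        · simp only [Finset.mem_filter, hy, true_and]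
          revert hv hxy
          cases b x <;> cases b y <;> cases v <;> simp
        · simp [hv]
    have h1 := key true
    have h2 := key false
    omega
  obtain ⟨f, hf, hcr⟩ := ih T.card hT T hbal rfl
  have hmemT : ∀ z, z ∈ T ↔ z ≠ y ∧ z ≠ x ∧ z ∈ S := fun z => by simp [T]
  let g : Fin m → Fin m := fun z => if z = x then y else if z = y then x else f z
  have gx : g x = y := if_pos rfl
  have gy : g y = x := by simp [g, hlt.ne']
  have gT : ∀ z, z ≠ y → z ≠ x → g z = f z := fun z h1 h2 => by simp [g, h1, h2]
  have hST : ∀ z ∈ S, z = x ∨ z = y ∨ (z ∈ T ∧ g z = f z ∧ f z ∈ S ∧ f z ≠ x ∧ f z ≠ y) := by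
    intro z hz
    by_cases h1 : z = x
    · exact .inl h1
    by_cases h2 : z = y
    · exact .inr (.inl h2)
    have hzT := (hmemT z).2 ⟨h2, h1, hz⟩
    have h3 := (hmemT _).1 (hf z hzT).1
    exact .inr (.inr ⟨hzT, gT z h2 h1, h3.2.2, h3.2.1, h3.1⟩)
  refine ⟨g, fun z hz => ?_, fun u hu v hv => ?_⟩
  · rcases hST z hz with rfl | rfl | ⟨hzT, hg, hfS, h1, h2⟩
    · rw [gx, gy]
      refine ⟨hy, rfl, ?_⟩
      revert hxy
      cases b z <;> cases b y <;> simp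
    · rw [gy, gx]
      refine ⟨hx, rfl, ?_⟩
      revert hxy
      cases b z <;> cases b x <;> simp
    · rw [hg, gT _ h2 h1]
      exact ⟨hfS, (hf z hzT).2⟩
  -- A crossing that involves the new chord would put an element of `S` between `x` and `y`; any
  -- other crossing is one of `f`.
  · rintro ⟨h1, h2, h3⟩
    rcases hST u hu with rfl | rfl | ⟨huT, hgu, hfu, -⟩
    · rw [gx] at h2
      exact hgap v hv ⟨h1, h2⟩
    · rw [gy] at h2
      exact absurd (h1.trans h2) hlt.not_gt
    · rw [hgu] at h2 h3
      rcases hST v hv with rfl | rfl | ⟨hvT, hgv, -⟩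
      · rw [gx] at h3
        exact hgap _ hfu ⟨h2, h3⟩
      · rw [gy] at h3
        exact absurd (h2.trans h3) hlt.not_gt
      · rw [hgv] at h3
        exact hcr u huT v hvT ⟨h1, h2, h3⟩

/-! ### Counting and summing over the edges of a tangle diagram -/

namespace TangleCode

variable (D : TangleCode)

/-- Each edge has one start and one end, and each strand at a crossing is the start of one edge and
the end of one edge; these contributions cancel. -/
theorem card_entry_eq : Fintype.card {i // D.entry i = true} =
    Fintype.card {i // D.entry i = false} := by
  have : Fintype Level := ⟨⟨{.over, .under}, by simp⟩, by rintro ⟨⟩ <;> simp⟩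
  have h := Fintype.card_congr D.next
  rw [Fintype.card_sum, Fintype.card_sum] at h
  omega

/-- The difference between the ends and the starts of all edges at crossings is concentrated at
the boundary points. -/
theorem sum_crossings {G : Type*} [AddCommGroup G] (f : D.Edge → G) :
    ∑ c : Fin D.crossings, ((f (.inl (c, .over)) - f (D.next.symm (.inl (c, .over)))) +
      (f (.inl (c, .under)) - f (D.next.symm (.inl (c, .under))))) =
    ∑ i : {i // D.entry i = false}, f (D.next.symm (.inr i)) -
      ∑ i : {i // D.entry i = true}, f (.inr i) := by
  let _ : Fintype Level := ⟨⟨{.over, .under}, by simp⟩, by rintro ⟨⟩ <;> simp⟩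
  have hL : ∀ g : Level → G, ∑ l, g l = g .over + g .under := fun g => by
    change (Multiset.map g {.over, .under}).sum = _
    simp
  -- The sum of `f` over all edges, indexed by their ends and by their starts. Splitting both sides
  -- into crossings and boundary points gives the claim.
  have h := Equiv.sum_comp D.next.symm f
  rw [Fintype.sum_sum_type, Fintype.sum_sum_type, Fintype.sum_prod_type, Fintype.sum_prod_type]
    at h
  simp only [hL, Finset.sum_add_distrib, Finset.sum_sub_distrib] at h ⊢
  rw [← sub_eq_zero] at h ⊢
  rw [← neg_eq_zero, ← h]
  abel

end TangleCode

namespace TangleDiagram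

variable (D : TangleDiagram)

/-- The noncrossing involution on all boundary points, with entries and exits as the two kinds,
restricts to a bijection from exits to entries. -/
theorem nonempty_closure : Nonempty D.Closure := by
  obtain ⟨f, hf, hcr⟩ := exists_noncrossing_involution D.entry Finset.univ (by
    rw [← Fintype.card_subtype, ← Fintype.card_subtype]
    exact D.card_entry_eq)
  have hff : ∀ x, f (f x) = x := fun x => (hf x (Finset.mem_univ x)).2.1
  have hb : ∀ x, D.entry (f x) = !D.entry x := fun x => (hf x (Finset.mem_univ x)).2.2
  have hcr' : ∀ x y, ¬ (x < y ∧ y < f x ∧ f x < f y) :=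
    fun x y => hcr x (Finset.mem_univ x) y (Finset.mem_univ y)
  refine ⟨⟨⟨fun i => ⟨f i, by rw [hb, i.2]; rfl⟩, fun i => ⟨f i, by rw [hb, i.2]; rfl⟩,
    fun i => Subtype.ext (hff i), fun i => Subtype.ext (hff i)⟩, ?_⟩⟩
  rintro ⟨p, -⟩ ⟨q, -⟩
  change ¬ (min p (f p) < min q (f q) ∧ min q (f q) < max p (f p) ∧ max p (f p) < max q (f q))
  -- The involution excludes only the pattern x < y < f x < f y, so it is applied with either end of
  -- each chord as the left one.
  have h1 := hcr' p q
  have h2 := hcr' p (f q)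
  have h3 := hcr' (f p) q
  have h4 := hcr' (f p) (f q)
  simp only [hff] at h2 h3 h4
  rcases le_total p (f p) with hp | hp <;> rcases le_total q (f q) with hq | hq <;>
    simp only [hp, hq, min_eq_left, min_eq_right, max_eq_left, max_eq_right] <;> assumption

variable {D}

/-! ### Colors of the regions along the boundary circle -/

/-- `-1` at a boundary point where a strand enters the disk, and `1` where it leaves. -/
def boundarySign (D : TangleDiagram) (i : Fin (2 * D.strands)) : ℤ :=
  if D.entry i then -1 else 1

/-- The boundary points inside an outer arc of a closure are matched with each other. -/
theorem Closure.sum_boundarySign_between (K : D.Closure) (p : {i // D.entry i = false}) :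
    ∑ t : Fin (2 * D.strands),
      (if min p.1 (K.join p).1 < t ∧ t < max p.1 (K.join p).1 then D.boundarySign t else 0) = 0 := by
  classical
  set a := min p.1 (K.join p).1 with ha
  set b := max p.1 (K.join p).1 with hb
  have hpj : ∀ (i : {i // D.entry i = false}) (j : {i // D.entry i = true}), i.1 ≠ j.1 :=
    fun i j h => by have := i.2; rw [h, j.2] at this; cases this
  -- Noncrossing means that no chord has exactly one end inside. For the chord `p` itself both sides
  -- are false, as the inequalities are strict.
  have hmem : ∀ q : {i // D.entry i = false},
      (a < q.1 ∧ q.1 < b) ↔ (a < (K.join q).1 ∧ (K.join q).1 < b) := by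
    intro q
    by_cases hq : q = p
    · subst hq
      simp only [ha, hb]
      rcases le_total q.1 (K.join q).1 with h | h <;> simp [h]
    have h1 := K.noncrossing p q
    have h2 := K.noncrossing q p
    have n1 : q.1 ≠ p.1 := fun h => hq (Subtype.ext h)
    have n2 : (K.join q).1 ≠ (K.join p).1 := fun h => hq (K.join.injective (Subtype.ext h))
    have n3 := hpj p (K.join q)
    have n4 := hpj q (K.join p)
    rcases le_total p.1 (K.join p).1 with h | h <;>
    rcases le_total q.1 (K.join q).1 with h' | h' <;>
    simp only [ha, hb, h, h', min_eq_left, min_eq_right, max_eq_left, max_eq_right] at h1 h2 ⊢ <;>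
    omega
  let ind : Fin (2 * D.strands) → ℤ := fun t => if a < t ∧ t < b then 1 else 0
  have hsplit := (Equiv.sumCompl fun i => D.entry i = true).sum_comp
    (fun t => if a < t ∧ t < b then D.boundarySign t else 0)
  rw [Fintype.sum_sum_type] at hsplit
  have hE : ∑ i : {i // D.entry i = true}, (if a < i.1 ∧ i.1 < b then D.boundarySign i.1 else 0)
      = - ∑ i : {i // D.entry i = true}, ind i.1 := by
    rw [← Finset.sum_neg_distrib]
    refine Finset.sum_congr rfl fun i _ => ?_
    simp only [ind, boundarySign, i.2, if_true]
    split_ifs <;> rfl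
  have hO : ∑ i : {i // ¬ D.entry i = true},
      (if a < i.1 ∧ i.1 < b then D.boundarySign i.1 else 0)
      = ∑ i : {i // D.entry i = false}, ind i.1 := by
    refine Fintype.sum_equiv (Equiv.subtypeEquivRight fun i => by simp) _ _ fun i => ?_
    simp only [ind, boundarySign, i.2, Equiv.subtypeEquivRight_apply_coe]
    rfl
  have hJ : ∑ i : {i // D.entry i = false}, ind i.1 = ∑ i : {i // D.entry i = true}, ind i.1 := by
    rw [← K.join.sum_comp]
    refine Finset.sum_congr rfl fun q _ => ?_
    simp only [ind, hmem q]
  rw [← hsplit]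
  change ∑ i : {i // D.entry i = true}, (if a < i.1 ∧ i.1 < b then D.boundarySign i.1 else 0) +
    ∑ i : {i // ¬ D.entry i = true}, (if a < i.1 ∧ i.1 < b then D.boundarySign i.1 else 0) = 0
  rw [hE, hO, hJ, neg_add_cancel]

variable {X : Type*} [Quandle X]

/-- The colors of the regions on the two sides of a boundary point. -/
theorem ccw_color_eq (α : D.diagram.ShadowColoring X) (i : Fin (2 * D.strands)) :
    α.regionColor (D.diagram.region (D.boundaryEdge i) (D.ccwSide i)) =
      (Rack.act' (α.color (D.diagram.arc (D.boundaryEdge i))) ^ D.boundarySign i)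
        (α.regionColor (D.diagram.region (D.boundaryEdge i) (D.cwSide i))) := by
  have h := α.region_rule (D.boundaryEdge i)
  -- Passing an entering strand counterclockwise goes from left to right, against the normal, hence
  -- the inverse action; a leaving strand is passed along its normal.
  by_cases hi : D.entry i = true
  · simp only [TangleCode.ccwSide, TangleCode.cwSide, boundarySign, hi, if_true, h, zpow_neg,
      zpow_one]
    exact ((Rack.act' _).symm_apply_apply _).symm
  · simp only [TangleCode.ccwSide, TangleCode.cwSide, boundarySign, hi, Bool.false_eq_true, if_false, zpow_one, h]
    rfl

/-- The colors of the regions before two boundary points differ by a power of the action of the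
common color of the boundary points. -/
theorem cw_color_eq (α : D.diagram.ShadowColoring X) {a : X}
    (ha : ∀ i, α.color (D.diagram.arc (D.boundaryEdge i)) = a) (k : Fin (2 * D.strands)) (d : ℕ)
    (hd : (k : ℕ) + d < 2 * D.strands) :
    α.regionColor (D.diagram.region (D.boundaryEdge ⟨k + d, hd⟩) (D.cwSide ⟨k + d, hd⟩)) =
      (Rack.act' a ^ ∑ t : Fin (2 * D.strands),
        (if k ≤ t ∧ (t : ℕ) < k + d then D.boundarySign t else 0))
        (α.regionColor (D.diagram.region (D.boundaryEdge k) (D.cwSide k))) := by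
  induction d with
  | zero =>
    have h0 : ∀ t : Fin (2 * D.strands), ¬ (k ≤ t ∧ (t : ℕ) < k + 0) := fun t => by omega
    rw [Finset.sum_eq_zero fun t _ => if_neg (h0 t)]
    rfl
  | succ d ih =>
    have hd' : (k : ℕ) + d < 2 * D.strands := by omega
    -- The walk stays within the numbering, so the cyclic successor does not wrap around.
    have hrot : finRotate _ (⟨k + d, hd'⟩ : Fin (2 * D.strands)) = ⟨k + (d + 1), hd⟩ := by
      have hrot' : ∀ (M j : ℕ) (h : j < M) (h' : j + 1 < M), finRotate M ⟨j, h⟩ = ⟨j + 1, h'⟩ := by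
        rintro (_ | M) j h h'
        · omega
        · exact finRotate_of_lt (by omega)
      exact hrot' _ _ hd' hd
    have hstep : D.diagram.region (D.boundaryEdge ⟨k + d, hd'⟩) (D.ccwSide ⟨k + d, hd'⟩) =
        D.diagram.region (D.boundaryEdge ⟨k + (d + 1), hd⟩) (D.cwSide ⟨k + (d + 1), hd⟩) := by
      rw [← hrot]
      exact Quot.sound (.cobounds (.mk _))
    have hsum : ∑ t : Fin (2 * D.strands),
        (if k ≤ t ∧ (t : ℕ) < k + (d + 1) then D.boundarySign t else 0) =
        D.boundarySign ⟨k + d, hd'⟩ + ∑ t : Fin (2 * D.strands),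
          (if k ≤ t ∧ (t : ℕ) < k + d then D.boundarySign t else 0) := by
      rw [← Finset.sum_erase_add _ _ (Finset.mem_univ (⟨k + d, hd'⟩ : Fin (2 * D.strands))),
        ← Finset.sum_erase_add (a := (⟨k + d, hd'⟩ : Fin (2 * D.strands)))
          (f := fun t : Fin (2 * D.strands) =>
            if k ≤ t ∧ (t : ℕ) < k + d then D.boundarySign t else 0) _ (Finset.mem_univ _),
        if_pos ⟨Fin.le_def.2 (by simp), by simp⟩, if_neg (by simp), add_zero, add_comm]
      congr 1
      refine Finset.sum_congr rfl fun t ht => ?_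
      have hne : (t : ℕ) ≠ k + d := fun h => Finset.ne_of_mem_erase ht (Fin.ext h)
      exact if_congr (by omega) rfl rfl
    rw [← hstep, ccw_color_eq, ha, ih hd', hsum, zpow_add]
    rfl

/-- The regions at the two ends of an outer arc have the same colors. -/
theorem Closure.regionColor_join (K : D.Closure) (α : D.diagram.ShadowColoring X)
    (hα : D.BoundaryMonochromatic α.toColoring) (p : {i // D.entry i = false}) (s : Side) :
    α.regionColor (D.diagram.region (D.next.symm (.inr p)) s) =
      α.regionColor (D.diagram.region (.inr (K.join p)) s) := by
  have hp : D.boundaryEdge p.1 = D.next.symm (.inr p) := by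
    simp [TangleCode.boundaryEdge, p.2]
  have hj : D.boundaryEdge (K.join p).1 = .inr (K.join p) := by
    simp [TangleCode.boundaryEdge, (K.join p).2]
  have hcol := hα p.1 (K.join p).1
  have hne : p.1 ≠ (K.join p).1 := fun h => by
    have := p.2
    rw [h, (K.join p).2] at this
    cases this
  have hsum := K.sum_boundarySign_between p
  -- Starting on the counterclockwise side of `k` leaves out the sign of `k`, so only the points
  -- strictly between contribute.
  have main : ∀ k l : Fin (2 * D.strands), k < l →
      ∑ t : Fin (2 * D.strands), (if k < t ∧ t < l then D.boundarySign t else 0) = 0 →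
      α.regionColor (D.diagram.region (D.boundaryEdge l) (D.cwSide l)) =
        α.regionColor (D.diagram.region (D.boundaryEdge k) (D.ccwSide k)) := by
    intro k l hkl h0
    obtain ⟨d, hd⟩ : ∃ d, (l : ℕ) = k + d := ⟨l - k, by omega⟩
    have hl : l = ⟨k + d, hd ▸ l.2⟩ := Fin.ext hd
    have h1 := cw_color_eq α (fun i => hα i k) k d (hd ▸ l.2)
    rw [← hl] at h1
    rw [h1, ccw_color_eq]
    congr 2
    rw [← Finset.sum_erase_add _ _ (Finset.mem_univ k)] at h0 ⊢
    rw [if_neg (by simp), add_zero] at h0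
    rw [if_pos ⟨le_rfl, by omega⟩]
    conv_rhs => rw [← zero_add (D.boundarySign k), ← h0]
    congr 1
    refine Finset.sum_congr rfl fun t ht => ?_
    have hne := Finset.ne_of_mem_erase ht
    exact if_congr (by omega) rfl rfl
  have rp := α.region_rule (D.boundaryEdge p.1)
  have rj := α.region_rule (D.boundaryEdge (K.join p).1)
  rw [← hp, ← hj]
  -- `main` compares the sides facing each other: the left sides if the exit comes first, the right
  -- sides otherwise. The remaining side follows because both ends have the same color and its
  -- action is bijective.
  rcases lt_or_gt_of_ne hne with h | h
  · have hm := main _ _ h (by simpa only [min_eq_left h.le, max_eq_right h.le] using hsum)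
    simp only [TangleCode.cwSide, TangleCode.ccwSide, p.2, (K.join p).2, if_true,
      Bool.false_eq_true, if_false] at hm
    cases s with
    | left => exact hm.symm
    | right =>
      rw [rp, rj, hcol] at hm
      exact ((Rack.act' _).injective hm).symm
  · have hm := main _ _ h (by simpa only [min_eq_right h.le, max_eq_left h.le] using hsum)
    simp only [TangleCode.cwSide, TangleCode.ccwSide, p.2, (K.join p).2, if_true,
      Bool.false_eq_true, if_false] at hm
    cases s with
    | right => exact hm
    | left => rw [rp, rj, hcol]; exact congrArg (· ⋆ _) hm

/-! ### Extensions to closures -/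

end TangleDiagram

theorem Diagram.arc_overIn (K : Diagram) (c : K.Crossing) :
    K.arc (K.overIn c) = K.arc (K.overOut c) :=
  Quot.sound (ArcStep.over (K := K) c)

namespace Diagram

variable {K : Diagram} {c : K.Crossing}

theorem underSource_of_pos (h : K.sign c = 1) : K.underSource c = K.arc (K.underIn c) :=
  if_pos h

theorem underTarget_of_pos (h : K.sign c = 1) : K.underTarget c = K.arc (K.underOut c) :=
  if_pos h

theorem sourceRegion_of_pos (h : K.sign c = 1) :
    K.sourceRegion c = K.region (K.overOut c) .right :=
  if_pos h

theorem underSource_of_neg (h : K.sign c = -1) : K.underSource c = K.arc (K.underOut c) :=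
  if_neg (by rw [h]; decide)

theorem underTarget_of_neg (h : K.sign c = -1) : K.underTarget c = K.arc (K.underIn c) :=
  if_neg (by rw [h]; decide)

theorem sourceRegion_of_neg (h : K.sign c = -1) :
    K.sourceRegion c = K.region (K.overIn c) .right :=
  if_neg (by rw [h]; decide)

end Diagram

namespace TangleDiagram

namespace Closure

section Inclusion

variable {D : TangleDiagram} {X : Type*} {K : D.Closure}

theorem color_underSource {β : K.diagram.Arc → X} {α : D.diagram.Arc → X}
    (h : ∀ e : D.Edge, β (K.diagram.arc (.inl e)) = α (D.diagram.arc e))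
    (c : Fin D.crossings) : β (K.diagram.underSource c) = α (D.diagram.underSource c) := by
  have hs : K.diagram.sign c = D.diagram.sign c := rfl
  unfold Diagram.underSource
  rw [hs]
  split_ifs <;> exact h _

theorem color_underTarget {β : K.diagram.Arc → X} {α : D.diagram.Arc → X}
    (h : ∀ e : D.Edge, β (K.diagram.arc (.inl e)) = α (D.diagram.arc e))
    (c : Fin D.crossings) : β (K.diagram.underTarget c) = α (D.diagram.underTarget c) := by
  have hs : K.diagram.sign c = D.diagram.sign c := rfl
  unfold Diagram.underTarget
  rw [hs]
  split_ifs <;> exact h _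

theorem regionColor_sourceRegion {β : K.diagram.Region → X} {α : D.diagram.Region → X}
    (h : ∀ (e : D.Edge) (s : Side), β (K.diagram.region (.inl e) s) = α (D.diagram.region e s))
    (c : Fin D.crossings) : β (K.diagram.sourceRegion c) = α (D.diagram.sourceRegion c) := by
  have hs : K.diagram.sign c = D.diagram.sign c := rfl
  unfold Diagram.sourceRegion
  rw [hs]
  split_ifs <;> exact h _ _

end Inclusion

variable {D : TangleDiagram} {X : Type*} [Quandle X] {K : D.Closure}

/-- The edge of the tangle diagram whose colors a piece of the closure receives: an outer arc is
treated as part of the edge that it continues. -/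
def innerEdge : D.Edge ⊕ {i // D.entry i = false} → D.Edge :=
  Sum.elim id fun i => D.next.symm (.inr i)

/-- Both edges meet the boundary circle. This equality makes the color of an outer arc consistent
where it reenters the disk. -/
theorem color_join (K : D.Closure) (α : D.diagram.Coloring X) (hα : D.BoundaryMonochromatic α)
    (i : {i // D.entry i = false}) :
    α.color (D.diagram.arc (D.next.symm (.inr i))) =
      α.color (D.diagram.arc (.inr (K.join i))) := by
  have h := hα i.1 (K.join i).1
  simpa [TangleCode.boundaryEdge, i.2, (K.join i).2] using h

/-- The colors of the arcs of a closure that extend a boundary-monochromatic coloring. -/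
def extendColor (K : D.Closure) (α : D.diagram.Coloring X) (hα : D.BoundaryMonochromatic α) :
    K.diagram.Arc → X :=
  Quot.lift (fun p => α.color (D.diagram.arc (innerEdge p))) (by
    rintro _ _ (c | hc)
    · exact congrArg α.color (D.diagram.arc_overIn c)
    · cases hc with
      | leave i => rfl
      | enter i => exact K.color_join α hα i)

/-- The extension of a boundary-monochromatic coloring to a closure. -/
def extendColoring (K : D.Closure) (α : D.diagram.Coloring X) (hα : D.BoundaryMonochromatic α) :
    K.diagram.Coloring X where
  color := K.extendColor α hα
  rule c :=
    (color_underTarget (β := K.extendColor α hα) (fun _ => rfl) c).trans <| (α.rule c).trans <|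
      congrArg (· ⋆ α.color (D.diagram.arc (D.diagram.overIn c)))
        (color_underSource (β := K.extendColor α hα) (fun _ => rfl) c).symm

/-- The extension of a boundary-monochromatic shadow coloring to a closure. -/
def extendShadowColoring (K : D.Closure) (α : D.diagram.ShadowColoring X)
    (hα : D.BoundaryMonochromatic α.toColoring) : K.diagram.ShadowColoring X where
  toColoring := K.extendColoring α.toColoring hα
  regionColor := Quot.lift (fun p => α.regionColor (D.diagram.region (innerEdge p.1) p.2)) (by
    intro x y h
    cases h with
    | pos₁ h => exact congrArg α.regionColor (Quot.sound (.pos₁ h))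
    | pos₂ h => exact congrArg α.regionColor (Quot.sound (.pos₂ h))
    | pos₃ h => exact congrArg α.regionColor (Quot.sound (.pos₃ h))
    | pos₄ h => exact congrArg α.regionColor (Quot.sound (.pos₄ h))
    | neg₁ h => exact congrArg α.regionColor (Quot.sound (.neg₁ h))
    | neg₂ h => exact congrArg α.regionColor (Quot.sound (.neg₂ h))
    | neg₃ h => exact congrArg α.regionColor (Quot.sound (.neg₃ h))
    | neg₄ h => exact congrArg α.regionColor (Quot.sound (.neg₄ h))
    -- Leaving the disk is trivial, since `innerEdge` identifies an outer arc with the edge it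
    -- continues. Entering it is the only place that needs the walk along the boundary circle.
    | continues s hc =>
      cases hc with
      | leave i => rfl
      | enter i => exact K.regionColor_join α hα i s
    | cobounds hc =>
      cases hc with
      | segment h => exact congrArg α.regionColor (Quot.sound (.cobounds h)))
  region_rule p := α.region_rule (innerEdge p)

/-- An outer arc and the edge it continues lie on the same arc of the closure, so an extension has
no freedom outside the disk. -/
theorem color_eq_innerEdge {β : K.diagram.Coloring X} {α : D.diagram.Coloring X}
    (h : K.Extends β α) (p : D.Edge ⊕ {i // D.entry i = false}) :
    β.color (K.diagram.arc p) = α.color (D.diagram.arc (innerEdge p)) := by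
  rcases p with e | i
  · exact h e
  · rw [show K.diagram.arc (.inr i) = K.diagram.arc (.inl (D.next.symm (.inr i))) from
      (Quot.sound (.continues (.leave i))).symm]
    exact h _

theorem regionColor_eq_innerEdge {β : K.diagram.ShadowColoring X} {α : D.diagram.ShadowColoring X}
    (h : K.ShadowExtends β α) (p : D.Edge ⊕ {i // D.entry i = false}) (s : Side) :
    β.regionColor (K.diagram.region p s) = α.regionColor (D.diagram.region (innerEdge p) s) := by
  rcases p with e | i
  · exact h.2 e s
  · rw [show K.diagram.region (.inr i) s = K.diagram.region (.inl (D.next.symm (.inr i))) s from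
      (Quot.sound (.continues s (.leave i))).symm]
    exact h.2 _ s

theorem Extends.unique {β β' : K.diagram.Coloring X} {α : D.diagram.Coloring X}
    (h : K.Extends β α) (h' : K.Extends β' α) : β = β' := by
  have hc : β.color = β'.color := funext fun x => by
    obtain ⟨p, rfl⟩ := Quot.exists_rep x
    exact (color_eq_innerEdge h p).trans (color_eq_innerEdge h' p).symm
  cases β
  cases β'
  cases hc
  rfl

theorem ShadowExtends.unique {β β' : K.diagram.ShadowColoring X} {α : D.diagram.ShadowColoring X}
    (h : K.ShadowExtends β α) (h' : K.ShadowExtends β' α) : β = β' := by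
  have h1 : β.toColoring = β'.toColoring := h.1.unique h'.1
  have hc : β.regionColor = β'.regionColor := funext fun x => by
    obtain ⟨⟨p, s⟩, rfl⟩ := Quot.exists_rep x
    exact (regionColor_eq_innerEdge h p s).trans (regionColor_eq_innerEdge h' p s).symm
  cases β
  cases β'
  cases h1
  cases hc
  rfl

/-- All crossings lie in the disk, where the two colorings agree; the right-hand side does not
involve the closure. -/
theorem Extends.chain_eq {β : K.diagram.Coloring X} {α : D.diagram.Coloring X}
    (h : K.Extends β α) : β.chain = α.chain := by
  refine Finset.sum_congr rfl fun c _ => ?_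
  have hs : β.color (K.diagram.underSource c) = α.color (D.diagram.underSource c) :=
    color_underSource h c
  rw [hs]
  exact congrArg (fun y => (D.sign c : ℤ) • Submodule.Quotient.mk
    (Finsupp.single ![α.color (D.diagram.underSource c), y] 1)) (h _)

theorem ShadowExtends.chain_eq {β : K.diagram.ShadowColoring X} {α : D.diagram.ShadowColoring X}
    (h : K.ShadowExtends β α) : β.chain = α.chain := by
  refine Finset.sum_congr rfl fun c _ => ?_
  have hs : β.color (K.diagram.underSource c) = α.color (D.diagram.underSource c) :=
    color_underSource h.1 c
  have hr : β.regionColor (K.diagram.sourceRegion c) = α.regionColor (D.diagram.sourceRegion c) :=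
    regionColor_sourceRegion h.2 c
  rw [hs, hr]
  exact congrArg (fun y => (D.sign c : ℤ) • Submodule.Quotient.mk
    (Finsupp.single ![α.regionColor (D.diagram.sourceRegion c),
      α.color (D.diagram.underSource c), y] 1)) (h.1 _)

end Closure

end TangleDiagram

/-! ### The chains are cycles -/

section Boundary

variable {X : Type*} [Quandle X]

theorem quandleBoundary_pair (x y : X) :
    quandleBoundary X 1 (Submodule.Quotient.mk (Finsupp.single ![x, y] 1)) =
      Submodule.Quotient.mk (Finsupp.single ![x] 1) -
        Submodule.Quotient.mk (Finsupp.single ![x ⋆ y] 1) := by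
  change Submodule.Quotient.mk (rackBoundary X 1 _) = _
  rw [← Submodule.Quotient.mk_sub]
  congr 1
  have h1 : delFace (Fin.succ (0 : Fin 1)) ![x, y] = ![x] := by
    funext i; fin_cases i; rfl
  have h2 : actFace (Fin.succ (0 : Fin 1)) ![x, y] = ![x ⋆ y] := by
    funext i; fin_cases i; rfl
  rw [rackBoundary, Finsupp.linearCombination_single, one_smul, Fin.sum_univ_one, h1, h2]
  norm_num

/-- Grouped by strands: at a crossing the first difference belongs to the two over-edges, the second
to the two under-edges. -/
theorem quandleBoundary_triple (w x y : X) :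
    quandleBoundary X 2 (Submodule.Quotient.mk (Finsupp.single ![w, x, y] 1)) =
      (Submodule.Quotient.mk (Finsupp.single ![w, y] 1) -
        Submodule.Quotient.mk (Finsupp.single ![w ⋆ x, y] 1)) +
      (Submodule.Quotient.mk (Finsupp.single ![w ⋆ y, x ⋆ y] 1) -
        Submodule.Quotient.mk (Finsupp.single ![w, x] 1)) := by
  change Submodule.Quotient.mk (rackBoundary X 2 _) = _
  rw [← Submodule.Quotient.mk_sub, ← Submodule.Quotient.mk_sub, ← Submodule.Quotient.mk_add]
  congr 1
  have h1 : delFace (Fin.succ (0 : Fin 2)) ![w, x, y] = ![w, y] := by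
    funext i; fin_cases i <;> rfl
  have h2 : actFace (Fin.succ (0 : Fin 2)) ![w, x, y] = ![w ⋆ x, y] := by
    funext i; fin_cases i <;> rfl
  have h3 : delFace (Fin.succ (1 : Fin 2)) ![w, x, y] = ![w, x] := by
    funext i; fin_cases i <;> rfl
  have h4 : actFace (Fin.succ (1 : Fin 2)) ![w, x, y] = ![w ⋆ y, x ⋆ y] := by
    funext i; fin_cases i <;> rfl
  rw [rackBoundary, Finsupp.linearCombination_single, one_smul, Fin.sum_univ_two, h1, h2, h3, h4]
  norm_num

end Boundary

namespace TangleDiagram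

variable {D : TangleDiagram} {X : Type*} [Quandle X]

/-- The boundary points left over by `sum_crossings` cancel in pairs along the outer arcs. -/
theorem Closure.sum_crossings_eq_zero (K : D.Closure) {G : Type*} [AddCommGroup G] (f : D.Edge → G)
    (hf : ∀ i, f (D.next.symm (.inr i)) = f (.inr (K.join i))) :
    ∑ c : Fin D.crossings, ((f (.inl (c, .over)) - f (D.next.symm (.inl (c, .over)))) +
      (f (.inl (c, .under)) - f (D.next.symm (.inl (c, .under))))) = 0 := by
  rw [D.sum_crossings, sub_eq_zero, ← K.join.sum_comp]
  exact Finset.sum_congr rfl fun i _ => hf i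

theorem coloring_chain_mem_cycles (α : D.diagram.Coloring X) (hα : D.BoundaryMonochromatic α) :
    α.chain ∈ quandleCycles X 2 := by
  obtain ⟨K⟩ := D.nonempty_closure
  let f : D.Edge → QuandleChain X 1 := fun e =>
    Submodule.Quotient.mk (Finsupp.single ![α.color (D.diagram.arc e)] 1)
  have hz := K.sum_crossings_eq_zero f fun i => by
    simp only [f, K.color_join α hα i]
  change quandleBoundary X 1 α.chain = 0
  -- For either sign, a signed term has boundary incoming minus outgoing under-edge, opposite to the
  -- convention in `hz`; hence the negation.
  rw [Diagram.Coloring.chain, map_sum, ← neg_eq_zero, ← hz, ← Finset.sum_neg_distrib]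
  refine Finset.sum_congr rfl fun (c : D.diagram.Crossing) _ => ?_
  have hover : f (.inl (c, .over)) = f (D.next.symm (.inl (c, .over))) :=
    congrArg (fun a => (Submodule.Quotient.mk (Finsupp.single ![α.color a] 1) : QuandleChain X 1))
      (D.diagram.arc_overIn c).symm
  rw [hover, sub_self, zero_add, map_smul, quandleBoundary_pair, ← α.rule]
  rcases Int.units_eq_one_or (D.diagram.sign c) with h' | h'
  · rw [Diagram.underTarget_of_pos h', Diagram.underSource_of_pos h', h']
    rw [Units.val_one, one_smul, neg_sub]
    rfl
  · rw [Diagram.underTarget_of_neg h', Diagram.underSource_of_neg h', h']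
    rw [Units.val_neg, Units.val_one, neg_smul, one_smul, neg_neg]
    rfl

theorem shadowColoring_chain_mem_cycles (α : D.diagram.ShadowColoring X)
    (hα : D.BoundaryMonochromatic α.toColoring) : α.chain ∈ quandleCycles X 3 := by
  obtain ⟨K⟩ := D.nonempty_closure
  -- An edge carries the pair of the color on its right and its own color. With source corner w, the
  -- region rule turns the right sides of the four edges into w (twice), w ⋆ x and w ⋆ y, the
  -- entries of the boundary formula.
  let f : D.Edge → QuandleChain X 2 := fun e => Submodule.Quotient.mk
    (Finsupp.single ![α.regionColor (D.diagram.region e .right), α.color (D.diagram.arc e)] 1)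
  have hz := K.sum_crossings_eq_zero f fun i => by
    simp only [f, K.color_join α.toColoring hα i, K.regionColor_join α hα i]
  change quandleBoundary X 2 α.chain = 0
  rw [Diagram.ShadowColoring.chain, map_sum, ← hz]
  refine Finset.sum_congr rfl fun (c : D.diagram.Crossing) _ => ?_
  have hover : α.color (D.diagram.arc (D.diagram.overOut c)) =
      α.color (D.diagram.arc (D.diagram.overIn c)) :=
    congrArg α.color (D.diagram.arc_overIn c).symm
  have hrule := α.rule c
  have rUI := α.region_rule (D.diagram.underIn c)
  have rUO := α.region_rule (D.diagram.underOut c)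
  have rOI := α.region_rule (D.diagram.overIn c)
  have rOO := α.region_rule (D.diagram.overOut c)
  change _ = ((Submodule.Quotient.mk (Finsupp.single ![α.regionColor (D.diagram.region
      (D.diagram.overOut c) .right), α.color (D.diagram.arc (D.diagram.overOut c))] 1) -
    Submodule.Quotient.mk (Finsupp.single ![α.regionColor (D.diagram.region
      (D.diagram.overIn c) .right), α.color (D.diagram.arc (D.diagram.overIn c))] 1)) +
    (Submodule.Quotient.mk (Finsupp.single ![α.regionColor (D.diagram.region
      (D.diagram.underOut c) .right), α.color (D.diagram.arc (D.diagram.underOut c))] 1) -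
    Submodule.Quotient.mk (Finsupp.single ![α.regionColor (D.diagram.region
      (D.diagram.underIn c) .right), α.color (D.diagram.arc (D.diagram.underIn c))] 1)) :
      QuandleChain X 2)
  rw [map_smul, quandleBoundary_triple]
  rcases Int.units_eq_one_or (D.diagram.sign c) with h' | h'
  · have e1 : α.regionColor (D.diagram.region (D.diagram.overOut c) .left) =
        α.regionColor (D.diagram.region (D.diagram.underOut c) .right) :=
      congrArg α.regionColor (Quot.sound (.pos₁ h'))
    have e3 : α.regionColor (D.diagram.region (D.diagram.overIn c) .right) =
        α.regionColor (D.diagram.region (D.diagram.underIn c) .left) :=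
      congrArg α.regionColor (Quot.sound (.pos₃ h'))
    have e4 : α.regionColor (D.diagram.region (D.diagram.underIn c) .right) =
        α.regionColor (D.diagram.region (D.diagram.overOut c) .right) :=
      congrArg α.regionColor (Quot.sound (.pos₄ h'))
    rw [Diagram.underTarget_of_pos h', Diagram.underSource_of_pos h'] at hrule
    rw [Diagram.sourceRegion_of_pos h', Diagram.underSource_of_pos h', h', Units.val_one,
      one_smul, ← e1, rOO, e3, rUI, e4, hover, hrule]
  · have e2 : α.regionColor (D.diagram.region (D.diagram.underIn c) .right) =
        α.regionColor (D.diagram.region (D.diagram.overIn c) .left) :=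
      congrArg α.regionColor (Quot.sound (.neg₂ h'))
    have e3 : α.regionColor (D.diagram.region (D.diagram.overIn c) .right) =
        α.regionColor (D.diagram.region (D.diagram.underOut c) .right) :=
      congrArg α.regionColor (Quot.sound (.neg₃ h'))
    have e4 : α.regionColor (D.diagram.region (D.diagram.underOut c) .left) =
        α.regionColor (D.diagram.region (D.diagram.overOut c) .right) :=
      congrArg α.regionColor (Quot.sound (.neg₄ h'))
    rw [Diagram.underTarget_of_neg h', Diagram.underSource_of_neg h'] at hrule
    rw [Diagram.sourceRegion_of_neg h', Diagram.underSource_of_neg h', h', Units.val_neg,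
      Units.val_one, neg_smul, one_smul, e2, rOI, ← e4, rUO, e3, hover, hrule]
    abel

end TangleDiagram

end QuandleTangle

theorem lemma8 {X : Type*} [Quandle X] (D : TangleDiagram) :
    Nonempty D.Closure ∧
    (∀ α : D.diagram.Coloring X, D.BoundaryMonochromatic α →
      (∀ K : D.Closure, ∃! β : K.diagram.Coloring X, K.Extends β α) ∧
      ∃! z : QuandleHomology X 2, ∀ (K : D.Closure) (β : K.diagram.Coloring X),
        K.Extends β α → Represents β.chain z) ∧
    (∀ α : D.diagram.ShadowColoring X, D.BoundaryMonochromatic α.toColoring →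
      (∀ K : D.Closure, ∃! β : K.diagram.ShadowColoring X, K.ShadowExtends β α) ∧
      ∃! z : QuandleHomology X 3, ∀ (K : D.Closure) (β : K.diagram.ShadowColoring X),
        K.ShadowExtends β α → Represents β.chain z) := by
  refine ⟨D.nonempty_closure, fun α hα => ⟨fun K => ?_, ?_⟩, fun α hα => ⟨fun K => ?_, ?_⟩⟩
  · exact ⟨K.extendColoring α hα, fun _ => rfl, fun _ h => h.unique fun _ => rfl⟩
  · refine ⟨Submodule.Quotient.mk ⟨α.chain, TangleDiagram.coloring_chain_mem_cycles α hα⟩,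
      fun K β h => ?_, fun z hz => ?_⟩
    · rw [h.chain_eq]
      exact ⟨_, rfl⟩
    -- Uniqueness needs a closure with an extension; otherwise the condition on `z` would be
    -- vacuous.
    · obtain ⟨K⟩ := D.nonempty_closure
      have h : K.Extends (K.extendColoring α hα) α := fun _ => rfl
      have hr := hz K _ h
      rw [h.chain_eq] at hr
      exact hr.2.symm
  · exact ⟨K.extendShadowColoring α hα, ⟨fun _ => rfl, fun _ _ => rfl⟩,
      fun _ h => h.unique ⟨fun _ => rfl, fun _ _ => rfl⟩⟩
  · refine ⟨Submodule.Quotient.mk ⟨α.chain, TangleDiagram.shadowColoring_chain_mem_cycles α hα⟩,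
      fun K β h => ?_, fun z hz => ?_⟩
    · rw [h.chain_eq]
      exact ⟨_, rfl⟩
    · obtain ⟨K⟩ := D.nonempty_closure
      have h : K.ShadowExtends (K.extendShadowColoring α hα) α :=
        ⟨fun _ => rfl, fun _ _ => rfl⟩
      have hr := hz K _ h
      rw [h.chain_eq] at hr
      exact hr.2.symm
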